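/- Let $n$ be a natural number. The rotational hyperoctahedral group $G'\subset SO(n)$ is the group of rotations that map the hyperoctahedron (the polytope in $\mathbb{R}^n$ with vertices $\pm e_1,\dots,\pm e_n$) onto itself. For paths $R_1,R_2:[0,1]\to SO(n)$ starting at the identity, the product $R_1R_2$ is the path starting at the identity given by $(R_1R_2)(t)=R_2(2t)$ for $t<\tfrac12$ and $(R_1R_2)(t)=R_1(2t-1)R_2(1)$ for $t\ge\tfrac12$; a product of several paths is bracketed as $R_1(R_2(\cdots R_k))$, and the empty product is the constant path at the identity. For an ordered pair of indices $i\ne j$, the generating path $R_{ij}$ is the path $t\mapsto$ (rotation by the angle $t\pi/2$ in the coordinate plane $ij$, from $e_i$ towards $e_j$), $t\in[0,1]$. Then for every $r\in G'$, every homotopy class (with fixed end points) of paths in $SO(n)$ from the identity to $r$ contains a path which is a finite product of generating paths $R_{ij}$. -/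

import Mathlib

open scoped unitInterval

/-- The rotation group `SO(n)`, with the topology of a subspace of the real `n × n` matrices. -/
abbrev SO (n : ℕ) : Type := Matrix.specialOrthogonalGroup (Fin n) ℝ

noncomputable section

/-- The vertices `±e₁, …, ±eₙ` of the hyperoctahedron in dimension `n`. -/
def hyperoctahedronVertices (n : ℕ) : Set (Fin n → ℝ) :=
  {v | ∃ i : Fin n, v = Pi.single i 1 ∨ v = -Pi.single i 1}

/-- The hyperoctahedron (cross polytope) in dimension `n`. -/
def hyperoctahedron (n : ℕ) : Set (Fin n → ℝ) :=
  convexHull ℝ (hyperoctahedronVertices n)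

/-- The rotational hyperoctahedral group: the rotations that map the hyperoctahedron onto
itself. -/
def rotationalHyperoctahedralGroup (n : ℕ) : Subgroup (SO n) where
  carrier := {A | (fun v => A.1.mulVec v) '' hyperoctahedron n = hyperoctahedron n}
  one_mem' := by simp
  mul_mem' := by
    intro A B hA hB
    have h : (fun v => (A * B).1.mulVec v) =
        (fun v => A.1.mulVec v) ∘ (fun v => B.1.mulVec v) := by
      funext v
      simp [Matrix.mulVec_mulVec]
    simp only [Set.mem_ofPred_eq] at hA hB ⊢
    rw [h, Set.image_comp, hB, hA]
  inv_mem' := by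
    intro A hA
    have h : (fun v => (A⁻¹).1.mulVec v) ∘ (fun v => A.1.mulVec v) = id := by
      funext v
      have h1 : (A⁻¹).1 * A.1 = 1 := congrArg Subtype.val (inv_mul_cancel A)
      simp [Matrix.mulVec_mulVec, h1]
    simp only [Set.mem_ofPred_eq] at hA ⊢
    conv_lhs => rw [← hA]
    rw [← Set.image_comp, h, Set.image_id]

/-- The matrix of the rotation by the angle `θ` in the coordinate plane `ij`, from the `i`-th
towards the `j`-th axis: `eᵢ ↦ cos θ eᵢ + sin θ eⱼ`, `eⱼ ↦ -sin θ eᵢ + cos θ eⱼ`, and the other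
basis vectors are fixed. -/
def planeRotationMatrix {n : ℕ} (i j : Fin n) (θ : ℝ) : Matrix (Fin n) (Fin n) ℝ :=
  1 + (Real.cos θ - 1) • (Matrix.single i i 1 + Matrix.single j j 1)
    + Real.sin θ • (Matrix.single j i 1 - Matrix.single i j 1)

theorem planeRotationMatrix_mul {n : ℕ} {i j : Fin n} (hij : i ≠ j) (θ φ : ℝ) :
    planeRotationMatrix i j θ * planeRotationMatrix i j φ = planeRotationMatrix i j (θ + φ) := by
  simp only [planeRotationMatrix, Real.cos_add, Real.sin_add]
  simp [-Matrix.smul_single, add_mul, mul_add, sub_mul, mul_sub, hij, hij.symm]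
  module

theorem planeRotationMatrix_transpose {n : ℕ} (i j : Fin n) (θ : ℝ) :
    (planeRotationMatrix i j θ).transpose = planeRotationMatrix i j (-θ) := by
  simp only [planeRotationMatrix, Real.cos_neg, Real.sin_neg]
  simp
  module

theorem planeRotationMatrix_zero {n : ℕ} (i j : Fin n) :
    planeRotationMatrix i j 0 = 1 := by
  simp [planeRotationMatrix]

theorem planeRotationMatrix_mem {n : ℕ} {i j : Fin n} (hij : i ≠ j) (θ : ℝ) :
    planeRotationMatrix i j θ ∈ Matrix.specialOrthogonalGroup (Fin n) ℝ := by
  have horth : ∀ φ : ℝ,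
      planeRotationMatrix i j φ * (planeRotationMatrix i j φ).transpose = 1 := by
    intro φ
    rw [planeRotationMatrix_transpose, planeRotationMatrix_mul hij, add_neg_cancel,
      planeRotationMatrix_zero]
  rw [Matrix.mem_specialOrthogonalGroup_iff, Matrix.mem_orthogonalGroup_iff]
  refine ⟨horth θ, ?_⟩
  have h := congrArg Matrix.det (horth (θ / 2))
  rw [Matrix.det_mul, Matrix.det_transpose, Matrix.det_one] at h
  rw [← add_halves θ, ← planeRotationMatrix_mul hij, Matrix.det_mul, h]

/-- The rotation by the angle `θ` in the coordinate plane `ij`, as an element of `SO(n)`. -/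
def planeRotation {n : ℕ} {i j : Fin n} (hij : i ≠ j) (θ : ℝ) : SO n :=
  ⟨planeRotationMatrix i j θ, planeRotationMatrix_mem hij θ⟩

theorem planeRotation_zero {n : ℕ} {i j : Fin n} (hij : i ≠ j) :
    planeRotation hij 0 = 1 :=
  Subtype.ext (planeRotationMatrix_zero i j)

theorem continuous_planeRotation {n : ℕ} {i j : Fin n} (hij : i ≠ j) :
    Continuous (planeRotation hij) := by
  refine Continuous.subtype_mk ?_ _
  unfold planeRotationMatrix
  fun_prop

/-- Continuous paths `[0,1] → SO(n)` starting at the identity, together with their end point. -/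
abbrev PathFromOne (n : ℕ) : Type := Σ A : SO n, Path (1 : SO n) A

namespace PathFromOne

/-- The constant path at the identity. -/
def one (n : ℕ) : PathFromOne n := ⟨1, Path.refl 1⟩

/-- The product `R₁R₂` of two paths starting at the identity: first `R₂`, and then `R₁`
translated on the right by the end point of `R₂`, that is `R₂(2t)` for `t ≤ 1/2` and
`R₁(2t-1) R₂(1)` for `t ≥ 1/2`. -/
def mul {n : ℕ} (R₁ R₂ : PathFromOne n) : PathFromOne n :=
  ⟨R₁.1 * R₂.1,
    R₂.2.trans ((R₁.2.map (continuous_mul_const R₂.1)).cast (one_mul R₂.1).symm rfl)⟩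

/-- The generating path `R_{ij}`: the rotation from `0` to `π/2` in the coordinate plane `ij`. -/
def generating {n : ℕ} {i j : Fin n} (hij : i ≠ j) : PathFromOne n :=
  ⟨planeRotation hij (Real.pi / 2),
    { toFun := fun t => planeRotation hij ((t : ℝ) * (Real.pi / 2))
      continuous_toFun := (continuous_planeRotation hij).comp (by fun_prop)
      source' := by simp [planeRotation_zero]
      target' := by simp }⟩

/-- The product `R₁(R₂(⋯ R_k))` of a list of paths starting at the identity; the empty product is
the constant path. -/
def listProd {n : ℕ} : List (PathFromOne n) → PathFromOne n
  | [] => one n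
  | [R] => R
  | R :: S :: L => mul R (listProd (S :: L))

/-- `R` is one of the generating paths `R_{ij}`, `i ≠ j`. -/
def IsGenerating {n : ℕ} (R : PathFromOne n) : Prop :=
  ∃ (i j : Fin n) (hij : i ≠ j), R = generating hij

/-- `R` is a (finite) product of generating paths. -/
def IsProductOfGenerating {n : ℕ} (R : PathFromOne n) : Prop :=
  ∃ L : List (PathFromOne n), (∀ S ∈ L, IsGenerating S) ∧ R = listProd L

end PathFromOne

end

/-! The proof inducts on a set `T` of coordinates: a path from the identity in the rotations fixing
`eᵢ` for `i ∉ T`, with integral end point, is homotopic to a concatenation of quarter turns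
(`isTurning_of_mem_fixing`). Rotations preserving the hyperoctahedron are integral, so `T = univ`
gives the theorem.

To pass from `T` to `insert k T`, follow the image of `e_k` on the unit sphere, which is covered by
the open hemispheres `±xᵢ > 0`. Cut the path into pieces each lying over one hemisphere, keeping the
part traversed so far in the form `p.trans δ`, with `p` made of quarter turns and `δ` over a single
hemisphere. A change of hemisphere is absorbed by inserting a quarter turn and its inverse
(`exists_homotopic_change_hemisphere`).

At the end `δ` joins two integral rotations `C` and `A`, both sending `e_k` to the centre of the
hemisphere. Thus `C⁻¹δ` keeps the image of `e_k` in the hemisphere around `e_k`, and a product of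
two reflections deforms it into rotations fixing `e_k` (`exists_homotopic_fixing`), where the
induction hypothesis applies. Finally `trans_left_translate` undoes the left translation by `C`. -/

/-! ### Homotopies of paths -/

namespace Path.Homotopic

variable {X : Type*} [TopologicalSpace X]

/-- The two ways around the boundary of a continuous square are homotopic. -/
theorem of_square {a b c d : X} {F : I × I → X} (hF : Continuous F)
    {p : Path a b} {q : Path b d} {p' : Path a c} {q' : Path c d}
    (hp : ∀ t, p t = F (t, 0)) (hq : ∀ t, q t = F (1, t))
    (hp' : ∀ t, p' t = F (0, t)) (hq' : ∀ t, q' t = F (t, 1)) :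
    (p.trans q).Homotopic (p'.trans q') := by
  have ha : F (0, 0) = a := by rw [← hp 0, p.source]
  have hb : F (1, 0) = b := by rw [← hp 1, p.target]
  have hc : F (0, 1) = c := by rw [← hp' 1, p'.target]
  have hd : F (1, 1) = d := by rw [← hq 1, q.target]
  subst ha hb hc hd
  let e₁ : Path ((0, 0) : I × I) (1, 0) := ⟨⟨fun t => (t, 0), by fun_prop⟩, rfl, rfl⟩
  let e₂ : Path ((1, 0) : I × I) (1, 1) := ⟨⟨fun t => (1, t), by fun_prop⟩, rfl, rfl⟩
  let e₃ : Path ((0, 0) : I × I) (0, 1) := ⟨⟨fun t => (0, t), by fun_prop⟩, rfl, rfl⟩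
  let e₄ : Path ((0, 1) : I × I) (1, 1) := ⟨⟨fun t => (t, 1), by fun_prop⟩, rfl, rfl⟩
  have : ContractibleSpace I := (convex_Icc (0 : ℝ) 1).contractibleSpace ⟨0, by simp⟩
  -- The square is simply connected, so its two boundary routes are homotopic there; `F` carries the
  -- homotopy to `X`.
  have h := (SimplyConnectedSpace.paths_homotopic (e₁.trans e₂) (e₃.trans e₄)).map ⟨F, hF⟩
  have h₁ : e₁.map hF = p := Path.ext (funext fun t => (hp t).symm)
  have h₂ : e₂.map hF = q := Path.ext (funext fun t => (hq t).symm)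
  have h₃ : e₃.map hF = p' := Path.ext (funext fun t => (hp' t).symm)
  have h₄ : e₄.map hF = q' := Path.ext (funext fun t => (hq' t).symm)
  rw [← h₁, ← h₂, ← h₃, ← h₄, ← Path.map_trans, ← Path.map_trans]
  exact h

/-- A property of paths starting at a given point, invariant under homotopy and under appending
small pieces of the path `γ`, holds for `γ` as soon as it holds for the constant path. -/
theorem induction_of_cover {ι : Type*} {x y : X} (γ : Path x y) (U : ι → Set X)
    (hU : ∀ i, IsOpen (U i)) (hγ : ∀ t, ∃ i, γ t ∈ U i)
    (S : ∀ ⦃z : X⦄, Path x z → Prop)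
    (homotopic : ∀ ⦃z : X⦄ (p q : Path x z), p.Homotopic q → S p → S q)
    (refl : S (Path.refl x))
    (trans : ∀ ⦃z w : X⦄ (p : Path x z) (q : Path z w), S p → Set.range q ⊆ Set.range γ →
      (∃ i, ∀ t, q t ∈ U i) → S (p.trans q)) :
    S γ := by
  obtain ⟨t, ht0, htm, ⟨N, hN⟩, hc⟩ := exists_monotone_Icc_subset_open_cover_unitInterval
    (fun i => (hU i).preimage γ.continuous)
    (fun s _ => Set.mem_iUnion.2 (hγ s))
  have key : ∀ n, S ((γ.subpath 0 (t n)).cast γ.source.symm rfl) := by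
    intro n
    induction n with
    | zero =>
      -- `t 0 = 0` holds only propositionally and occurs in the type of the path, hence the
      -- generalization.
      have : ∀ s, s = 0 → S ((γ.subpath 0 s).cast γ.source.symm rfl) := by
        rintro _ rfl
        have : ∀ w (hw : w = x) (p : Path x w), (∀ t, p t = w) → S p := by
          rintro w rfl p hp
          rwa [show p = Path.refl w from Path.ext (funext hp)]
        exact this _ γ.source _ (fun t => by simp)
      exact this _ ht0
    | succ n ih =>
      have h := trans _ (γ.subpath (t n) (t (n + 1))) ih
        (by rw [Path.range_subpath]; exact Set.image_subset_range _ _)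
        (by
          obtain ⟨i, hi⟩ := hc n
          refine ⟨i, fun s => ?_⟩
          have : γ.subpath (t n) (t (n + 1)) s ∈ γ '' Set.Icc (t n) (t (n + 1)) := by
            rw [← Path.range_subpath_of_le _ _ _ (htm n.le_succ)]
            exact ⟨s, rfl⟩
          obtain ⟨u, hu, hs⟩ := this
          rw [← hs]
          exact hi hu)
      refine homotopic _ _ ?_ h
      exact (Path.Homotopic.pathCast ⟨Path.Homotopy.subpathTransSubpath γ 0 (t n) (t (n + 1))⟩
        γ.source.symm rfl)
  have := key N
  rw [hN N le_rfl] at this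
  have h2 : ∀ w (hw : w = y) (p : Path x w), (∀ t, p t = γ t) → S p → S γ := by
    rintro w rfl p hp h
    rwa [show γ = p from Path.ext (funext fun t => (hp t).symm)]
  exact h2 _ γ.target _ (fun t => by simp) this

end Path.Homotopic

/-! ### Paths composed of quarter turns -/

noncomputable section

/-- The path `t ↦ Q(t) A`, where `Q` is the generating path `R_{ij}`. -/
def IsQuarterTurn {n : ℕ} {A B : SO n} (q : Path A B) : Prop :=
  ∃ (i j : Fin n) (hij : i ≠ j), ∀ t, q t = planeRotation hij ((t : ℝ) * (Real.pi / 2)) * A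

/-- The quarter turn in the plane `ij` starting at `A`. -/
def quarterTurn {n : ℕ} {i j : Fin n} (hij : i ≠ j) (A : SO n) :
    Path A (planeRotation hij (Real.pi / 2) * A) where
  toFun t := planeRotation hij ((t : ℝ) * (Real.pi / 2)) * A
  continuous_toFun := ((continuous_planeRotation hij).comp (by fun_prop)).mul continuous_const
  source' := by simp [planeRotation_zero]
  target' := by simp

/-- The paths starting at `A` which are homotopic to a concatenation of quarter turns. -/
inductive IsTurning {n : ℕ} (A : SO n) : ∀ ⦃B : SO n⦄, Path A B → Prop
  | refl (p : Path A A) (hp : p.Homotopic (Path.refl A)) : IsTurning A p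
  | step ⦃B C : SO n⦄ (p : Path A B) (q : Path B C) (r : Path A C) (hp : IsTurning A p)
      (hq : IsQuarterTurn q) (hr : r.Homotopic (p.trans q)) : IsTurning A r

namespace IsTurning

open Path.Homotopic

variable {n : ℕ} {A B C : SO n}

theorem of_homotopic {p q : Path A B} (h : q.Homotopic p) (hp : IsTurning A p) :
    IsTurning A q := by
  cases hp with
  | refl p hp => exact .refl _ (h.trans hp)
  | step p₁ p₂ _ h₁ h₂ h₃ => exact .step p₁ p₂ _ h₁ h₂ (h.trans h₃)

theorem trans {p : Path A B} (hp : IsTurning A p) {q : Path B C} (hq : IsTurning B q) :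
    IsTurning A (p.trans q) := by
  induction hq with
  | refl q hq =>
    exact hp.of_homotopic ((Path.Homotopic.hcomp (.refl p) hq).trans (Path.Homotopic.trans_refl p))
  | step q₁ q₂ q _ hq₂ h ih =>
    refine .step _ q₂ _ ih hq₂ ((Path.Homotopic.hcomp (.refl p) h).trans ?_)
    exact (Path.Homotopic.trans_assoc p q₁ q₂).symm

/-- Quarter turns act by left multiplication, which commutes with right translation. -/
theorem map_mul_const {p : Path A B} (hp : IsTurning A p) (C : SO n) :
    IsTurning (A * C) (p.map (continuous_mul_const C)) := by
  induction hp with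
  | refl p hp => exact .refl _ (hp.map ⟨_, continuous_mul_const C⟩)
  | step p q r _ hq hr ih =>
    refine .step _ (q.map (continuous_mul_const C)) _ ih ?_ ?_
    · obtain ⟨i, j, hij, h⟩ := hq
      exact ⟨i, j, hij, fun t => by simp [h, mul_assoc]⟩
    · rw [← Path.map_trans]
      exact hr.map ⟨_, continuous_mul_const C⟩

/-- The path `p` followed by the translate of `h` by the end point of `p` is a composition of
quarter turns, if `p` and `h` are. -/
theorem trans_left_translate {p : Path (1 : SO n) A} (hp : IsTurning 1 p)
    {h : Path (1 : SO n) B} (hh : IsTurning 1 h) {q : Path A C} (hq : ∀ t, q t = A * h t) :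
    IsTurning 1 (p.trans q) := by
  have hC : C = A * B := by rw [← q.target, hq, h.target]
  subst hC
  have h₂ := hp.map_mul_const B
  have h₃ : IsTurning B ((p.map (continuous_mul_const B)).cast (one_mul B).symm rfl) := by
    have aux : ∀ (D : SO n) (hD : D = 1 * B), IsTurning D
        ((p.map (continuous_mul_const B)).cast hD rfl) := by
      rintro _ rfl
      exact h₂
    exact aux _ _
  refine (hh.trans h₃).of_homotopic ?_
  -- One way round this square is `p`, then `A * h`; the other is `h`, then `p * B`, which involves
  -- only a right translate.
  refine of_square (F := fun s => p s.1 * h s.2) (by fun_prop) ?_ ?_ ?_ ?_ <;>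
    simp [hq]

end IsTurning

namespace PathFromOne

theorem mk_cast {n : ℕ} {A B : SO n} (p : Path (1 : SO n) A) (h : B = A) :
    (⟨B, p.cast rfl h⟩ : PathFromOne n) = ⟨A, p⟩ := by
  subst h
  rfl

/-- Only a homotopy is available when `R` is the empty product: `listProd [Q]` is `Q` itself,
whereas `mul Q (one n)` first waits at the identity. -/
theorem IsProductOfGenerating.exists_homotopic_mul {n : ℕ} {i j : Fin n} (hij : i ≠ j)
    {R : PathFromOne n} (hR : R.IsProductOfGenerating) :
    ∃ q : Path (1 : SO n) (mul (generating hij) R).1,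
      q.Homotopic (mul (generating hij) R).2 ∧ IsProductOfGenerating ⟨_, q⟩ := by
  obtain ⟨L, hL, rfl⟩ := hR
  cases L with
  | nil =>
    have hQ : (mul (generating hij) (one n)).1 = (generating hij).1 := mul_one _
    refine ⟨(generating hij).2.cast rfl hQ, ?_,
      [generating hij], by simpa using ⟨i, j, hij, rfl⟩, mk_cast _ hQ⟩
    have h : ((generating hij).2.map (continuous_mul_const (1 : SO n))).cast
        (one_mul (1 : SO n)).symm rfl = (generating hij).2.cast rfl hQ :=
      Path.ext (funext fun t => mul_one _)
    have h' : ((Path.refl (1 : SO n)).trans (((generating hij).2.map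
        (continuous_mul_const (1 : SO n))).cast (one_mul (1 : SO n)).symm rfl)).Homotopic
        ((generating hij).2.cast rfl hQ) := by
      rw [h]
      exact Path.Homotopic.refl_trans _
    exact h'.symm
  | cons S L =>
    refine ⟨_, .refl _, generating hij :: S :: L, ?_, rfl⟩
    intro T hT
    rcases List.mem_cons.1 hT with rfl | hT
    · exact ⟨i, j, hij, rfl⟩
    · exact hL T hT

end PathFromOne

theorem IsTurning.exists_homotopic_isProductOfGenerating {n : ℕ} {A : SO n}
    {p : Path (1 : SO n) A} (hp : IsTurning 1 p) :
    ∃ R : Path (1 : SO n) A, R.Homotopic p ∧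
      PathFromOne.IsProductOfGenerating (⟨A, R⟩ : PathFromOne n) := by
  induction hp with
  | refl p hp => exact ⟨Path.refl 1, hp.symm, [], by simp, rfl⟩
  | @step B C p q r _ hq hr ih =>
    obtain ⟨R, hR, hRp⟩ := ih
    obtain ⟨i, j, hij, hq⟩ := hq
    have hC : C = planeRotation hij (Real.pi / 2) * B := by
      rw [← q.target, hq]; simp
    subst hC
    obtain ⟨R', hR', hp'⟩ := hRp.exists_homotopic_mul hij
    refine ⟨R', hR'.trans (.trans ?_ hr.symm), hp'⟩
    have : ((PathFromOne.generating hij).2.map (continuous_mul_const B)).cast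
        (one_mul B).symm rfl = q :=
      Path.ext (funext fun t => (hq t).symm)
    unfold PathFromOne.mul
    dsimp only
    erw [this]
    exact .hcomp hR (.refl q)

end

/-! ### Matrices in `SO(n)` -/

section SpecialOrthogonal

open Matrix

variable {n : ℕ}

theorem SO.transpose_mul_self (A : SO n) : A.1ᵀ * A.1 = 1 :=
  (Matrix.mem_orthogonalGroup_iff' (Fin n) ℝ).1
    (Matrix.mem_specialOrthogonalGroup_iff.1 A.2).1

theorem SO.inv_val (A : SO n) : (A⁻¹).1 = A.1ᵀ := rfl

theorem SO.sum_mul_eq (A : SO n) (j k : Fin n) :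
    ∑ l, A.1 l j * A.1 l k = if j = k then 1 else 0 := by
  have h := congrFun (congrFun A.transpose_mul_self j) k
  rwa [Matrix.mul_apply, Matrix.one_apply] at h

theorem SO.continuous_apply (i j : Fin n) : Continuous fun A : SO n => A.1 i j :=
  (continuous_apply_apply i j).comp continuous_subtype_val

theorem planeRotation_mul_apply_left {i j : Fin n} (hij : i ≠ j) (θ : ℝ) (A : SO n) (k : Fin n) :
    (planeRotation hij θ * A).1 i k = Real.cos θ * A.1 i k - Real.sin θ * A.1 j k := by
  simp [planeRotation, planeRotationMatrix, Matrix.add_mul, Matrix.sub_mul, -Matrix.smul_single,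
    Matrix.single_mul_apply_of_ne, hij]
  ring

theorem planeRotation_mul_apply_right {i j : Fin n} (hij : i ≠ j) (θ : ℝ) (A : SO n)
    (k : Fin n) :
    (planeRotation hij θ * A).1 j k = Real.sin θ * A.1 i k + Real.cos θ * A.1 j k := by
  simp [planeRotation, planeRotationMatrix, Matrix.add_mul, Matrix.sub_mul, -Matrix.smul_single,
    Matrix.single_mul_apply_of_ne, hij.symm]
  ring

/-- The rotations fixing the basis vectors `eᵢ`, `i ∉ T`. -/
def fixing (T : Finset (Fin n)) : Subgroup (SO n) where
  carrier := {A | ∀ i ∉ T, A.1 *ᵥ Pi.single i 1 = Pi.single i 1}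
  one_mem' := fun i _ => Matrix.one_mulVec _
  mul_mem' := by
    intro A B hA hB i hi
    change (A.1 * B.1) *ᵥ _ = _
    rw [← Matrix.mulVec_mulVec, hB i hi, hA i hi]
  inv_mem' := by
    intro A hA i hi
    conv_lhs => rw [← hA i hi]
    rw [SO.inv_val, Matrix.mulVec_mulVec, SO.transpose_mul_self, Matrix.one_mulVec]

/-- Column `j` is `e_j`, and column `k` is orthogonal to it. -/
theorem apply_eq_zero_of_mem_fixing {T : Finset (Fin n)} {A : SO n} (hA : A ∈ fixing T)
    {j k : Fin n} (hj : j ∉ T) (hk : k ∈ T) : A.1 j k = 0 := by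
  have h := A.sum_mul_eq j k
  rw [if_neg (by rintro rfl; exact hj hk)] at h
  have h' : ∀ l, A.1 l j = Pi.single (M := fun _ => ℝ) j 1 l := fun l => by
    have := congrFun (hA j hj) l
    rwa [Matrix.mulVec_single_one] at this
  simpa [h', Pi.single_apply] using h

theorem exists_apply_ne_zero_of_mem_fixing {T : Finset (Fin n)} {A : SO n} (hA : A ∈ fixing T)
    {k : Fin n} (hk : k ∈ T) : ∃ j ∈ T, A.1 j k ≠ 0 := by
  by_contra! h
  have h0 : ∀ j, A.1 j k = 0 := fun j => by
    by_cases hj : j ∈ T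
    · exact h j hj
    · exact apply_eq_zero_of_mem_fixing hA hj hk
  have := A.sum_mul_eq k k
  simp [h0] at this

theorem eq_one_of_mem_fixing_empty {A : SO n} (hA : A ∈ fixing (∅ : Finset (Fin n))) : A = 1 := by
  refine Subtype.ext (Matrix.ext_of_mulVec_single fun i => ?_)
  rw [hA i (by simp)]
  exact (Matrix.one_mulVec _).symm

theorem planeRotation_mem_fixing {T : Finset (Fin n)} {i j : Fin n} (hij : i ≠ j) (hi : i ∈ T)
    (hj : j ∈ T) (θ : ℝ) : planeRotation hij θ ∈ fixing T := by
  intro l hl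
  have hli : l ≠ i := by rintro rfl; exact hl hi
  have hlj : l ≠ j := by rintro rfl; exact hl hj
  ext m
  simp [planeRotation, planeRotationMatrix, Matrix.one_apply,
    hli.symm, hlj.symm, Pi.single_apply]

/-- The rotations with integral matrix entries. -/
def integralRotations (n : ℕ) : Subgroup (SO n) where
  carrier := {A | ∀ i j, A.1 i j ∈ (Int.castRingHom ℝ).range}
  one_mem' := by
    intro i j
    change (1 : Matrix (Fin n) (Fin n) ℝ) i j ∈ _
    rw [Matrix.one_apply]
    split_ifs
    · exact one_mem _
    · exact zero_mem _
  mul_mem' := by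
    intro A B hA hB i j
    change (A.1 * B.1) i j ∈ _
    rw [Matrix.mul_apply]
    exact sum_mem fun l _ => mul_mem (hA i l) (hB l j)
  inv_mem' := fun hA i j => hA j i

/-- A column has norm one, and each nonzero integral entry already contributes at least one to the
sum of squares. -/
theorem abs_eq_one_of_mem_integralRotations {A : SO n} (hA : A ∈ integralRotations n)
    {i k : Fin n} (h : A.1 i k ≠ 0) : |A.1 i k| = 1 ∧ ∀ j, j ≠ i → A.1 j k = 0 := by
  have key : ∀ j, A.1 j k ≠ 0 → 1 ≤ A.1 j k ^ 2 := by
    intro j hj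
    obtain ⟨z, hz⟩ := hA j k
    rw [← hz] at hj ⊢
    have hz0 : z ≠ 0 := by rintro rfl; simp at hj
    have : 1 ≤ z ^ 2 := by
      have := Int.one_le_abs hz0
      nlinarith [sq_abs z]
    simpa using (by exact_mod_cast this : (1 : ℝ) ≤ (z : ℝ) ^ 2)
  have hs : ∑ l, A.1 l k ^ 2 = 1 := by
    simpa [sq] using A.sum_mul_eq k k
  rw [← Finset.add_sum_erase _ _ (Finset.mem_univ i)] at hs
  have h0 : 0 ≤ ∑ l ∈ Finset.univ.erase i, A.1 l k ^ 2 :=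
    Finset.sum_nonneg fun _ _ => sq_nonneg _
  have h1 := key i h
  constructor
  · rw [← sq_eq_sq₀ (abs_nonneg _) zero_le_one, sq_abs]
    linarith
  · intro j hj
    have := (Finset.sum_eq_zero_iff_of_nonneg (fun l _ => sq_nonneg (A.1 l k))).1
      (by linarith : ∑ l ∈ Finset.univ.erase i, A.1 l k ^ 2 = 0) j (by simp [hj])
    simpa using this

theorem planeRotation_pi_div_two_mem_integralRotations {i j : Fin n} (hij : i ≠ j) :
    planeRotation hij (Real.pi / 2) ∈ integralRotations n := by
  intro l m
  simp only [planeRotation, planeRotationMatrix, Real.cos_pi_div_two, Real.sin_pi_div_two]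
  simp only [Matrix.add_apply, Matrix.smul_apply, Matrix.sub_apply, Matrix.one_apply,
    Matrix.single_apply, smul_eq_mul]
  have h0 := zero_mem (Int.castRingHom ℝ).range
  have h1 := one_mem (Int.castRingHom ℝ).range
  refine add_mem (add_mem ?_ (mul_mem (sub_mem h0 h1) (add_mem ?_ ?_)))
    (mul_mem h1 (sub_mem ?_ ?_)) <;> split_ifs <;> assumption

theorem IsTurning.mem_integralRotations {A B : SO n} {p : Path A B} (hp : IsTurning A p)
    (hA : A ∈ integralRotations n) : B ∈ integralRotations n := by
  induction hp with
  | refl => exact hA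
  | step p q r _ hq hr ih =>
    obtain ⟨i, j, hij, hq⟩ := hq
    rw [← q.target, hq]
    exact mul_mem (by simpa using planeRotation_pi_div_two_mem_integralRotations hij) ih

/-- The rotations preserving the hyperoctahedron have integral matrices. -/
theorem rotationalHyperoctahedralGroup_le :
    rotationalHyperoctahedralGroup n ≤ integralRotations n := by
  intro A hA i k
  have hsub : hyperoctahedron n ⊆ {v | ∑ i, |v i| ≤ 1} := by
    refine convexHull_min ?_ ?_
    · rintro v ⟨l, rfl | rfl⟩ <;> simp [Pi.single_apply, apply_ite abs]
    · intro v hv w hw a b ha hb hab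
      calc ∑ l, |(a • v + b • w) l| ≤ ∑ l, (a * |v l| + b * |w l|) := by
            refine Finset.sum_le_sum fun l _ => (abs_add_le _ _).trans ?_
            simp [abs_mul, abs_of_nonneg ha, abs_of_nonneg hb]
        _ = a * ∑ l, |v l| + b * ∑ l, |w l| := by
            rw [Finset.sum_add_distrib, Finset.mul_sum, Finset.mul_sum]
        _ ≤ a * 1 + b * 1 := by
            gcongr
            · exact hv
            · exact hw
        _ = 1 := by linarith
  have hk : Pi.single k 1 ∈ hyperoctahedron n := subset_convexHull _ _ ⟨k, Or.inl rfl⟩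
  have h1 : A.1 *ᵥ Pi.single k 1 ∈ hyperoctahedron n := by
    have : (fun v => A.1 *ᵥ v) '' hyperoctahedron n = hyperoctahedron n := hA
    rw [← this]
    exact ⟨_, hk, rfl⟩
  have h2 : ∑ l, |A.1 l k| ≤ 1 := by
    have := hsub h1
    rwa [Matrix.mulVec_single_one] at this
  have hle : ∀ l, |A.1 l k| ≤ 1 := fun l =>
    (Finset.single_le_sum (f := fun l => |A.1 l k|) (fun _ _ => abs_nonneg _)
      (Finset.mem_univ l)).trans h2
  have hs : ∑ l, A.1 l k ^ 2 = 1 := by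
    simpa [sq] using A.sum_mul_eq k k
  -- Termwise `a² ≤ |a|`, while `∑ |a| ≤ 1 = ∑ a²`; so equality holds in every term and each entry
  -- is `0` or `±1`.
  have hnn : ∀ l ∈ Finset.univ, 0 ≤ |A.1 l k| - A.1 l k ^ 2 := fun l _ => by
    rw [← sq_abs]
    nlinarith [hle l, abs_nonneg (A.1 l k)]
  have hz : ∑ l, (|A.1 l k| - A.1 l k ^ 2) = 0 :=
    le_antisymm (by rw [Finset.sum_sub_distrib, hs]; linarith) (Finset.sum_nonneg hnn)
  have h := (Finset.sum_eq_zero_iff_of_nonneg hnn).1 hz i (Finset.mem_univ i)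
  have h' : |A.1 i k| * (1 - |A.1 i k|) = 0 := by
    rw [← sq_abs] at h
    linarith
  rcases mul_eq_zero.1 h' with h | h
  · rw [abs_eq_zero.1 h]
    exact zero_mem _
  · rcases eq_or_eq_neg_of_abs_eq (sub_eq_zero.1 h).symm with h | h <;> rw [h]
    · exact one_mem _
    · exact neg_mem (one_mem _)

end SpecialOrthogonal

/-! ### Householder reflections -/

noncomputable section Householder

open Matrix

variable {n : ℕ}

/-- The matrix of the reflection in the hyperplane orthogonal to `u`. -/
def householder (u : Fin n → ℝ) : Matrix (Fin n) (Fin n) ℝ :=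
  1 - (2 / (u ⬝ᵥ u)) • vecMulVec u u

theorem householder_mulVec (u v : Fin n → ℝ) :
    householder u *ᵥ v = v - (2 / (u ⬝ᵥ u) * (u ⬝ᵥ v)) • u := by
  rw [householder, Matrix.sub_mulVec, Matrix.one_mulVec, Matrix.smul_mulVec, vecMulVec_mulVec]
  simp [smul_smul]

/-- This keeps the end points fixed in the deformation of `exists_homotopic_fixing`. -/
theorem householder_smul {c : ℝ} (hc : c ≠ 0) (u : Fin n → ℝ) :
    householder (c • u) = householder u := by
  simp only [householder, smul_dotProduct, dotProduct_smul, smul_vecMulVec, vecMulVec_smul,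
    smul_smul, smul_eq_mul]
  by_cases hu : u ⬝ᵥ u = 0
  · simp [hu]
  · congr 2
    field_simp

theorem householder_transpose (u : Fin n → ℝ) : (householder u)ᵀ = householder u := by
  simp [householder, transpose_vecMulVec]

theorem householder_mul_self {u : Fin n → ℝ} (hu : u ≠ 0) :
    householder u * householder u = 1 := by
  have hu' : u ⬝ᵥ u ≠ 0 := by simpa using hu
  refine Matrix.ext_of_mulVec_single fun i => ?_
  rw [← Matrix.mulVec_mulVec, householder_mulVec, householder_mulVec, Matrix.one_mulVec,
    dotProduct_sub, dotProduct_smul, sub_sub, ← add_smul]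
  have : 2 / (u ⬝ᵥ u) * (u ⬝ᵥ Pi.single i 1) + 2 / (u ⬝ᵥ u) * (u ⬝ᵥ Pi.single i 1 -
      (2 / (u ⬝ᵥ u) * (u ⬝ᵥ Pi.single i 1)) • (u ⬝ᵥ u)) = 0 := by
    rw [smul_eq_mul]
    field_simp
    ring
  rw [this, zero_smul, sub_zero]

theorem householder_det {u : Fin n → ℝ} (hu : u ≠ 0) : (householder u).det = -1 := by
  have hu' : u ⬝ᵥ u ≠ 0 := by simpa using hu
  have h : householder u = 1 + replicateCol Unit ((-(2 / (u ⬝ᵥ u))) • u) * replicateRow Unit u := by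
    rw [← vecMulVec_eq, smul_vecMulVec, neg_smul, ← sub_eq_add_neg]
    rfl
  rw [h, det_one_add_replicateCol_mul_replicateRow, dotProduct_smul, smul_eq_mul]
  field_simp
  norm_num

theorem householder_mul_householder_mem {u w : Fin n → ℝ} (hu : u ≠ 0) (hw : w ≠ 0) :
    householder u * householder w ∈ Matrix.specialOrthogonalGroup (Fin n) ℝ := by
  rw [Matrix.mem_specialOrthogonalGroup_iff, Matrix.mem_orthogonalGroup_iff]
  constructor
  · change _ * (householder u * householder w)ᵀ = 1
    rw [Matrix.transpose_mul, householder_transpose, householder_transpose, Matrix.mul_assoc,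
      ← Matrix.mul_assoc (householder w), householder_mul_self hw, Matrix.one_mul,
      householder_mul_self hu]
  · rw [Matrix.det_mul, householder_det hu, householder_det hw]
    norm_num

theorem Continuous.householder {X : Type*} [TopologicalSpace X] {f : X → Fin n → ℝ}
    (hf : Continuous f) (h0 : ∀ x, f x ≠ 0) : Continuous fun x => householder (f x) := by
  have h1 : Continuous fun x => f x ⬝ᵥ f x := hf.dotProduct hf
  refine continuous_const.sub ((continuous_const.div h1 fun x => ?_).smul ?_)
  · simpa using h0 x
  · exact hf.matrix_vecMulVec hf

/-- If `v` and `w` have the same length, the reflection in `w + v` maps `v` to `-w`. -/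
theorem householder_add_mulVec {v w : Fin n → ℝ} (h : v ⬝ᵥ v = w ⬝ᵥ w) (h0 : w + v ≠ 0) :
    householder (w + v) *ᵥ v = -w := by
  have hu' : (w + v) ⬝ᵥ (w + v) ≠ 0 := mt dotProduct_self_eq_zero.1 h0
  have h2 : (w + v) ⬝ᵥ (w + v) = 2 * ((w + v) ⬝ᵥ v) := by
    simp only [add_dotProduct, dotProduct_add, dotProduct_comm v w, h]
    ring
  rw [householder_mulVec]
  have : 2 / ((w + v) ⬝ᵥ (w + v)) * ((w + v) ⬝ᵥ v) = 1 := by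
    rw [h2] at hu' ⊢
    field_simp
    exact div_self (right_ne_zero_of_mul hu')
  rw [this, one_smul]
  abel

/-- A path in `SO(n)` between rotations fixing `e_k`, along which the image of `e_k` stays in the
open hemisphere around `e_k`, is homotopic to a path of rotations fixing `e_k`. -/
theorem exists_homotopic_fixing {T : Finset (Fin n)} {k : Fin n} (hk : k ∉ T) {A : SO n}
    (p : Path (1 : SO n) A) (hp : ∀ t, p t ∈ fixing (insert k T))
    (hpos : ∀ t, 0 < (p t).1 k k) (hA : A.1 *ᵥ Pi.single k 1 = Pi.single k 1) :
    ∃ q : Path (1 : SO n) A, p.Homotopic q ∧ ∀ t, q t ∈ fixing T := by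
  set e : Fin n → ℝ := Pi.single k 1 with he
  have he0 : e ≠ 0 := by simp [he]
  let u : I × I → Fin n → ℝ := fun x => e + (x.2 : ℝ) • ((p x.1).1 *ᵥ e)
  have hu0 : ∀ x, u x ≠ 0 := by
    intro x hx
    have h := congrFun hx k
    have h1 : u x k = 1 + (x.2 : ℝ) * (p x.1).1 k k := by simp [u, he]
    rw [h1] at h
    have := mul_nonneg x.2.2.1 (hpos x.1).le
    simp only [Pi.zero_apply] at h
    linarith
  have hu : Continuous u := by
    have : Continuous fun x : I × I => (p x.1).1 :=
      continuous_subtype_val.comp (by fun_prop)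
    exact continuous_const.add ((by fun_prop : Continuous fun x : I × I => (x.2 : ℝ)).smul
      (this.matrix_mulVec continuous_const))
  -- At `s = 0` the two reflections cancel. At `s = 1` the first sends `p(t) e` to `-e` and the
  -- second returns it to `e`, so `e` is fixed.
  let F : I × I → SO n := fun x =>
    ⟨householder e * householder (u x), householder_mul_householder_mem he0 (hu0 x)⟩ * p x.1
  have hF : Continuous F :=
    (Continuous.subtype_mk (continuous_const.mul (hu.householder hu0)) _).mul (by fun_prop)
  have hfix : ∀ x, (p x.1).1 *ᵥ e = e → F x = p x.1 := by
    intro x hx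
    have h1 : u x = (1 + (x.2 : ℝ)) • e := by simp [u, hx, add_smul]
    have h2 : householder (u x) = householder e := by
      rw [h1, householder_smul]
      have := x.2.2.1
      positivity
    refine Subtype.ext ?_
    change householder e * householder (u x) * (p x.1).1 = _
    rw [h2, householder_mul_self he0, Matrix.one_mul]
  have hF0 : ∀ t, F (t, 0) = p t := by
    intro t
    refine Subtype.ext ?_
    change householder e * householder (u (t, 0)) * (p t).1 = _
    have : u (t, 0) = e := by simp [u]
    rw [this, householder_mul_self he0, Matrix.one_mul]
  have hFs : ∀ s, F (0, s) = 1 := fun s => by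
    rw [hfix _ (by simp)]; simp
  have hFt : ∀ s, F (1, s) = A := fun s => by
    rw [hfix _ (by simpa using hA)]; simp
  let q : Path (1 : SO n) A := ⟨⟨fun t => F (t, 1), by fun_prop⟩, hFs 1, hFt 1⟩
  have hsq : (p.trans (Path.refl A)).Homotopic ((Path.refl 1).trans q) :=
    Path.Homotopic.of_square hF (fun t => (hF0 t).symm) (fun s => (hFt s).symm)
      (fun s => (hFs s).symm) (fun t => rfl)
  refine ⟨q, (Path.Homotopic.trans_refl p).symm.trans
    (hsq.trans (Path.Homotopic.refl_trans q)), fun t i hi => ?_⟩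
  change (householder e * householder (u (t, 1)) * (p t).1) *ᵥ Pi.single i 1 = _
  rw [← Matrix.mulVec_mulVec, ← Matrix.mulVec_mulVec]
  by_cases hik : i = k
  · subst hik
    have h1 : u (t, 1) = e + (p t).1 *ᵥ e := by simp [u]
    have h2 : ((p t).1 *ᵥ e) ⬝ᵥ ((p t).1 *ᵥ e) = e ⬝ᵥ e := by
      rw [Matrix.dotProduct_mulVec, Matrix.vecMul_mulVec, (p t).transpose_mul_self,
        Matrix.vecMul_one]
    have h3 := hu0 (t, 1)
    rw [h1] at h3 ⊢
    rw [← he, householder_add_mulVec h2 h3, householder_mulVec]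
    simp [he]
    module
  · have hi' : i ∉ insert k T := by simp [hik, hi]
    have h1 : e ⬝ᵥ Pi.single i 1 = 0 := by simp [he, hik]
    -- Both mirror normals are orthogonal to `eᵢ`, so the deformation keeps `eᵢ` fixed.
    have h2 : u (t, 1) ⬝ᵥ Pi.single i 1 = 0 := by
      have := apply_eq_zero_of_mem_fixing (hp t) hi' (Finset.mem_insert_self k T)
      simp [u, he, hik, this]
    rw [hp t i hi', householder_mulVec (u _), h2, mul_zero, zero_smul, sub_zero, householder_mulVec, h1,
      mul_zero, zero_smul, sub_zero]

end Householder

/-! ### Generation of all homotopy classes -/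

section Generation

open Matrix Path.Homotopic

variable {n : ℕ}

theorem IsQuarterTurn.quarterTurn {i j : Fin n} (hij : i ≠ j) (A : SO n) :
    IsQuarterTurn (quarterTurn hij A) :=
  ⟨i, j, hij, fun _ => rfl⟩

/-- A quarter turn carrying the open hemisphere `0 < ε xᵢ` to `0 < ζ xⱼ`, and preserving the latter
on their intersection, moves the start of a path in the first hemisphere to the second one. -/
theorem exists_homotopic_of_quarterTurn {T : Finset (Fin n)} {i j k : Fin n} {ε ζ : ℝ}
    {a b : Fin n} (hab : a ≠ b) (ha : a ∈ T) (hb : b ∈ T)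
    (hcarry : ∀ A : SO n, 0 < ε * A.1 i k → 0 < ζ * (planeRotation hab (Real.pi / 2) * A).1 j k)
    (hstay : ∀ A : SO n, 0 < ε * A.1 i k → 0 < ζ * A.1 j k → ∀ t : I,
      0 < ζ * (planeRotation hab ((t : ℝ) * (Real.pi / 2)) * A).1 j k)
    {A B : SO n} {p : Path 1 A} (hp : IsTurning 1 p) {δ : Path A B}
    (hδ : ∀ t, δ t ∈ fixing T) (hpos : ∀ t, 0 < ε * (δ t).1 i k) (hB : 0 < ζ * B.1 j k) :
    ∃ (A' : SO n) (p' : Path 1 A') (δ' : Path A' B), IsTurning 1 p' ∧ (∀ t, δ' t ∈ fixing T) ∧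
      (∀ t, 0 < ζ * (δ' t).1 j k) ∧ (p.trans δ).Homotopic (p'.trans δ') := by
  let Q := planeRotation hab (Real.pi / 2)
  let μ : Path (Q * A) (Q * B) := δ.map (continuous_const_mul Q)
  -- Turning before or after `δ` gives homotopic paths, so `δ` can be replaced by the turn at `A`,
  -- then `μ = Qδ`, then the reversed turn at `B`. `hcarry` controls `μ` and `hstay` the reversed
  -- turn.
  have hsq : (δ.trans (quarterTurn hab B)).Homotopic ((quarterTurn hab A).trans μ) := by
    refine of_square
      (F := fun x => planeRotation hab ((x.2 : ℝ) * (Real.pi / 2)) * δ x.1) ?_ ?_ ?_ ?_ ?_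
    · exact ((continuous_planeRotation hab).comp (by fun_prop)).mul (by fun_prop)
    · intro t; simp [planeRotation_zero]
    · intro t; simp [quarterTurn]
    · intro t; simp [quarterTurn]
    · intro t; simp [μ, Q]
  have hmem : ∀ (P : SO n → Prop), (∀ t, P (μ t)) → (∀ t, P (quarterTurn hab B t)) →
      ∀ t, P ((μ.trans (quarterTurn hab B).symm) t) := by
    intro P h1 h2 t
    have : (μ.trans (quarterTurn hab B).symm) t ∈ Set.range μ ∪ Set.range (quarterTurn hab B) := by
      rw [← Path.symm_range (quarterTurn hab B), ← Path.trans_range]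
      exact ⟨t, rfl⟩
    rcases this with ⟨s, hs⟩ | ⟨s, hs⟩ <;> rw [← hs]
    · exact h1 s
    · exact h2 s
  refine ⟨_, p.trans (quarterTurn hab A), μ.trans (quarterTurn hab B).symm,
    .step p _ _ hp (.quarterTurn hab A) (.refl _), ?_, ?_, ?_⟩
  · refine hmem (· ∈ fixing T) (fun t => ?_) (fun t => ?_)
    · exact mul_mem (planeRotation_mem_fixing hab ha hb _) (hδ t)
    · exact mul_mem (planeRotation_mem_fixing hab ha hb _) (by simpa using hδ 1)
  · refine hmem (fun C => 0 < ζ * C.1 j k) (fun t => hcarry _ (hpos t)) (fun t => ?_)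
    exact hstay B (by simpa using hpos 1) hB t
  · rw [← Path.Homotopic.Quotient.eq] at hsq ⊢
    simp only [Path.Homotopic.Quotient.mk_trans, Path.Homotopic.Quotient.mk_symm] at hsq ⊢
    rw [Path.Homotopic.Quotient.trans_assoc, ← Path.Homotopic.Quotient.trans_assoc (Path.Homotopic.Quotient.mk (quarterTurn hab A)), ← hsq,
      Path.Homotopic.Quotient.trans_assoc, Path.Homotopic.Quotient.trans_symm, Path.Homotopic.Quotient.trans_refl]

/-- Change of hemispheres, for a composition of quarter turns followed by a path in a hemisphere. -/
theorem exists_homotopic_change_hemisphere {T : Finset (Fin n)} {i j k : Fin n}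
    (hi : i ∈ T) (hj : j ∈ T) {ε ζ : ℝ} (hε : ε = 1 ∨ ε = -1) (hζ : ζ = 1 ∨ ζ = -1)
    {A B : SO n} {p : Path 1 A} (hp : IsTurning 1 p) {δ : Path A B}
    (hδ : ∀ t, δ t ∈ fixing T) (hpos : ∀ t, 0 < ε * (δ t).1 i k) (hB : 0 < ζ * B.1 j k) :
    ∃ (A' : SO n) (p' : Path 1 A') (δ' : Path A' B), IsTurning 1 p' ∧ (∀ t, δ' t ∈ fixing T) ∧
      (∀ t, 0 < ζ * (δ' t).1 j k) ∧ (p.trans δ).Homotopic (p'.trans δ') := by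
  have hcos : ∀ t : I, 0 ≤ Real.cos ((t : ℝ) * (Real.pi / 2)) := fun t =>
    Real.cos_nonneg_of_mem_Icc ⟨by nlinarith [t.2.1, Real.pi_pos], by
      nlinarith [t.2.2, Real.pi_pos]⟩
  have hsin : ∀ t : I, 0 ≤ Real.sin ((t : ℝ) * (Real.pi / 2)) := fun t =>
    Real.sin_nonneg_of_nonneg_of_le_pi (by nlinarith [t.2.1, Real.pi_pos]) (by
      nlinarith [t.2.2, Real.pi_pos])
  -- Sine and cosine are nonnegative on the quarter circle and never vanish together.
  have hcomb : ∀ (t : I) (x y : ℝ), 0 < x → 0 < y →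
      0 < Real.sin ((t : ℝ) * (Real.pi / 2)) * x + Real.cos ((t : ℝ) * (Real.pi / 2)) * y := by
    intro t x y hx hy
    have h1 := mul_nonneg (hsin t) hx.le
    have h2 := mul_nonneg (hcos t) hy.le
    refine lt_of_le_of_ne (add_nonneg h1 h2) fun h => ?_
    have h3 : Real.sin ((t : ℝ) * (Real.pi / 2)) = 0 :=
      (mul_eq_zero.1 (by linarith : _ * x = 0)).resolve_right hx.ne'
    have h4 : Real.cos ((t : ℝ) * (Real.pi / 2)) = 0 :=
      (mul_eq_zero.1 (by linarith : _ * y = 0)).resolve_right hy.ne'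
    have := Real.sin_sq_add_cos_sq ((t : ℝ) * (Real.pi / 2))
    rw [h3, h4] at this
    norm_num at this
  by_cases hij : i = j
  · subst hij
    have h1 : 0 < ε * B.1 i k := by simpa using hpos 1
    -- Opposite hemispheres are disjoint, but `B` lies over both.
    have : ε = ζ := by
      rcases hε with rfl | rfl <;> rcases hζ with rfl | rfl <;> first | rfl | linarith
    subst this
    exact ⟨A, p, δ, hp, hδ, hpos, .refl _⟩
  · by_cases hεζ : ε = ζ
    · subst hεζ
      refine exists_homotopic_of_quarterTurn hij hi hj (fun C hC => ?_) (fun C h1 h2 t => ?_)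
        hp hδ hpos hB
      · rw [planeRotation_mul_apply_right]
        simpa using hC
      · rw [planeRotation_mul_apply_right]
        have := hcomb t _ _ h1 h2
        linarith
    · have hεζ' : ε = -ζ := by
        rcases hε with rfl | rfl <;> rcases hζ with rfl | rfl <;> simp at hεζ ⊢
      -- For opposite signs the turn goes from `e_j` towards `eᵢ`, since it takes `eᵢ` to `-e_j`.
      subst hεζ'
      refine exists_homotopic_of_quarterTurn (Ne.symm hij) hj hi (fun C hC => ?_)
        (fun C h1 h2 t => ?_) hp hδ hpos hB
      · rw [planeRotation_mul_apply_left]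
        simpa using hC
      · rw [planeRotation_mul_apply_left]
        have := hcomb t _ _ h1 h2
        linarith

/-- A path of rotations in a hemisphere between integral rotations, translated to start at the
identity, ends at a rotation fixing `e_k`, and stays in the hemisphere around `e_k`. -/
theorem hemisphere_left_translate {i k : Fin n} {ε : ℝ} {A B : SO n}
    (hA : A ∈ integralRotations n) (hε : ε = 1 ∨ ε = -1) (hpos : 0 < ε * A.1 i k)
    (hposB : 0 < ε * B.1 i k) :
    0 < (A⁻¹ * B).1 k k ∧ (B ∈ integralRotations n →
      (A⁻¹ * B).1 *ᵥ Pi.single k 1 = Pi.single k 1) := by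
  -- The only signed basis vector in the hemisphere `0 < ε xᵢ` is its centre `ε eᵢ`.
  have key : ∀ {C : SO n}, C ∈ integralRotations n → 0 < ε * C.1 i k →
      ∀ j, C.1 j k = if j = i then ε else 0 := by
    intro C hC h j
    obtain ⟨h1, h2⟩ := abs_eq_one_of_mem_integralRotations hC (right_ne_zero_of_mul h.ne')
    split_ifs with hj
    · subst hj
      rcases eq_or_eq_neg_of_abs_eq h1 with h1 | h1 <;> rcases hε with rfl | rfl <;>
        rw [h1] at h ⊢ <;> norm_num at h
    · exact h2 j hj
  constructor
  · change 0 < (A.1ᵀ * B.1) k k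
    rw [Matrix.mul_apply]
    simpa [key hA hpos] using hposB
  · intro hB
    have : B.1 *ᵥ Pi.single k 1 = A.1 *ᵥ Pi.single k 1 := by
      ext j
      simp [key hA hpos, key hB hposB]
    change (A.1ᵀ * B.1) *ᵥ _ = _
    rw [← Matrix.mulVec_mulVec, this, Matrix.mulVec_mulVec, A.transpose_mul_self,
      Matrix.one_mulVec]

theorem isTurning_of_mem_fixing (T : Finset (Fin n)) : ∀ {A : SO n} (γ : Path 1 A),
    (∀ t, γ t ∈ fixing T) → A ∈ integralRotations n → IsTurning 1 γ := by
  induction T using Finset.induction_on with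
  | empty =>
    intro A γ hγ _
    have hA : A = 1 := eq_one_of_mem_fixing_empty (by simpa using hγ 1)
    subst hA
    have : γ = Path.refl 1 := Path.ext (funext fun t => eq_one_of_mem_fixing_empty (hγ t))
    exact .refl γ (this ▸ .refl _)
  | insert k T hk ih =>
    intro A γ hγ hA
    have hkT := Finset.mem_insert_self k T
    have key := induction_of_cover γ
      (ι := {x : Fin n × ℝ // x.1 ∈ insert k T ∧ (x.2 = 1 ∨ x.2 = -1)})
      (fun x => {C | 0 < x.1.2 * C.1 x.1.1 k})
      (fun x => isOpen_lt continuous_const (continuous_const.mul (SO.continuous_apply _ _)))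
      (by
        intro t
        obtain ⟨j, hj, h⟩ := exists_apply_ne_zero_of_mem_fixing (hγ t) hkT
        rcases lt_or_gt_of_ne h with h | h
        · exact ⟨⟨(j, -1), hj, Or.inr rfl⟩, by simpa using h⟩
        · exact ⟨⟨(j, 1), hj, Or.inl rfl⟩, by simpa using h⟩)
      -- The invariant: up to homotopy, quarter turns followed by a path over one hemisphere.
      (fun B q => ∃ (C : SO n) (p : Path 1 C) (δ : Path C B) (i : Fin n) (ε : ℝ),
        i ∈ insert k T ∧ (ε = 1 ∨ ε = -1) ∧ IsTurning 1 p ∧ (∀ t, δ t ∈ fixing (insert k T)) ∧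
        (∀ t, 0 < ε * (δ t).1 i k) ∧ q.Homotopic (p.trans δ))
      (by
        rintro B q q' h ⟨C, p, δ, i, ε, hi, hε, hp, hδ, hpos, hq⟩
        exact ⟨C, p, δ, i, ε, hi, hε, hp, hδ, hpos, h.symm.trans hq⟩)
      ⟨1, Path.refl 1, Path.refl 1, k, 1, hkT, Or.inl rfl, .refl _ (.refl _),
        fun _ => one_mem _, by simp, (Path.Homotopic.refl_trans _).symm⟩
      (by
        rintro B D q η ⟨C, p, δ, i, ε, hi, hε, hp, hδ, hpos, hq⟩ hη ⟨⟨⟨j, ζ⟩, hj, hζ⟩, hηU⟩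
        obtain ⟨C', p', δ', hp', hδ', hpos', h⟩ :=
          exists_homotopic_change_hemisphere hi hj hε hζ hp hδ hpos (by simpa using hηU 0)
        have hη' : ∀ t, η t ∈ fixing (insert k T) := fun t => by
          obtain ⟨s, hs⟩ := hη ⟨t, rfl⟩
          rw [← hs]
          exact hγ s
        have hr : ∀ t, (δ'.trans η) t ∈ Set.range δ' ∪ Set.range η := fun t => by
          rw [← Path.trans_range]
          exact ⟨t, rfl⟩
        refine ⟨C', p', δ'.trans η, j, ζ, hj, hζ, hp', fun t => ?_, fun t => ?_, ?_⟩
        · rcases hr t with ⟨s, hs⟩ | ⟨s, hs⟩ <;> rw [← hs]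
          exacts [hδ' s, hη' s]
        · rcases hr t with ⟨s, hs⟩ | ⟨s, hs⟩ <;> rw [← hs]
          exacts [hpos' s, hηU s]
        · exact (Path.Homotopic.hcomp (hq.trans h) (.refl η)).trans
            (Path.Homotopic.trans_assoc p' δ' η))
    obtain ⟨C, p, δ, i, ε, hi, hε, hp, hδ, hpos, hγδ⟩ := key
    -- Integrality of the junction `C` puts its image of `e_k` at the centre of the hemisphere.
    have hC := hp.mem_integralRotations (one_mem _)
    have hC0 : 0 < ε * C.1 i k := by simpa using hpos 0
    let κ : Path (1 : SO n) (C⁻¹ * A) :=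
      (δ.map (continuous_const_mul C⁻¹)).cast (inv_mul_cancel C).symm rfl
    have hκ : ∀ t, κ t = C⁻¹ * δ t := fun _ => rfl
    obtain ⟨τ, hτ, hτT⟩ := exists_homotopic_fixing hk κ
      (fun t => mul_mem (inv_mem (by simpa using hδ 0)) (hδ t))
      (fun t => (hemisphere_left_translate hC hε hC0 (hpos t)).1)
      ((hemisphere_left_translate hC hε hC0 (by simpa using hpos 1)).2 hA)
    have hτt := ih τ hτT (mul_mem (inv_mem hC) hA)
    let ρ : Path C A := (τ.map (continuous_const_mul C)).cast (mul_one C).symm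
      (mul_inv_cancel_left C A).symm
    have hδ' : δ = (κ.map (continuous_const_mul C)).cast (mul_one C).symm
        (mul_inv_cancel_left C A).symm :=
      Path.ext (funext fun t => (mul_inv_cancel_left C (δ t)).symm)
    have hδρ : δ.Homotopic ρ := by
      rw [hδ']
      exact (hτ.map ⟨_, continuous_const_mul C⟩).pathCast _ _
    exact (hp.trans_left_translate hτt (q := ρ) fun _ => rfl).of_homotopic
      (hγδ.trans (.hcomp (.refl p) hδρ))

end Generation

theorem lemma1 (n : ℕ) (r : SO n) (hr : r ∈ rotationalHyperoctahedralGroup n)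
    (c : Path.Homotopic.Quotient (1 : SO n) r) :
    ∃ R : Path (1 : SO n) r, Path.Homotopic.Quotient.mk R = c ∧
      PathFromOne.IsProductOfGenerating (⟨r, R⟩ : PathFromOne n) := by
  obtain ⟨γ, rfl⟩ := Path.Homotopic.Quotient.mk_surjective c
  obtain ⟨R, hR, hp⟩ := (isTurning_of_mem_fixing Finset.univ γ
    (fun t i hi => absurd (Finset.mem_univ i) hi)
    (rotationalHyperoctahedralGroup_le hr)).exists_homotopic_isProductOfGenerating
  exact ⟨R, Path.Homotopic.Quotient.eq.2 hR, hp⟩
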